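/- Let $R$ and $Q$ be (associative, unital) rings and let $\varphi\colon R\to Q$ be a ring homomorphism that is both a monomorphism and an epimorphism in the category of rings; regard $Q$ as an $R$-$R$-bimodule via $\varphi$ and let $K=Q/\varphi(R)$, an $R$-$R$-bimodule. Assume that - $Q$ is flat as a left $R$-module; - $Q$ is directly finite, i.e. $xy=1$ implies $yx=1$ for all $x,y\in Q$; - the Gabriel topology $\mathcal F=\{\,I\mid I \text{ is a right ideal of } R \text{ and } \varphi(I)Q=Q\,\}$ is a 1-topology, i.e. every $I\in\mathcal F$ contains a principal right ideal $sR$ with $sR\in\mathcal F$. Call a right $R$-module $M$: *torsion* if $M\otimes_R Q=0$; *torsion-free* if its only torsion submodule is $0$; *$h$-divisible* if every homomorphism $R_R\to M_R$ extends along $\varphi$ to a homomorphism $Q_R\to M_R$; *$h$-reduced* if its only $h$-divisible submodule is $0$; *Matlis-cotorsion* if $\operatorname{Ext}^1_R(Q_R,M_R)=0$. Let $\mathcal C$ be the full subcategory of $\operatorname{Mod-}R$ consisting of the $h$-reduced torsion-free Matlis-cotorsion right $R$-modules, and let $\mathcal T$ be the full subcategory consisting of the $h$-divisible torsion right $R$-modules.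 Then $M\otimes_R K\in\mathcal T$ for every $M\in\mathcal C$, $\operatorname{Hom}(K_R,N)\in\mathcal C$ for every $N\in\mathcal T$ (with right $R$-action $(fr)(k)=f(rk)$), and the functors $$-\otimes_R K\colon\mathcal C\to\mathcal T\qquad\text{and}\qquad \operatorname{Hom}(K_R,-)\colon\mathcal T\to\mathcal C$$ are mutually quasi-inverse equivalences of categories. -/

import Mathlib

open CategoryTheory MulOpposite
open scoped TensorProduct

universe u

/-! Right `R`-modules are modules over `Rᵐᵒᵖ`: `x r` is written `op r • x`. -/

namespace Matlis

section Tensor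

/-- The relations `(x r) ⊗ y - x ⊗ (r y)` defining the tensor product over `R`. -/
def balancedRel (R M N : Type u) [Ring R] [AddCommGroup M] [Module Rᵐᵒᵖ M]
    [AddCommGroup N] [Module R N] : Submodule ℤ (M ⊗[ℤ] N) :=
  Submodule.span ℤ
    {t | ∃ (r : R) (x : M) (y : N), t = (op r • x) ⊗ₜ[ℤ] y - x ⊗ₜ[ℤ] (r • y)}

/-- The tensor product `M ⊗_R N` of a right `R`-module and a left `R`-module over a ring `R`
that need not be commutative; an abelian group. -/
def Tensor (R M N : Type u) [Ring R] [AddCommGroup M] [Module Rᵐᵒᵖ M]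
    [AddCommGroup N] [Module R N] : Type u :=
  (M ⊗[ℤ] N) ⧸ balancedRel R M N

variable {R M M' M'' N N' : Type u} [Ring R]
  [AddCommGroup M] [Module Rᵐᵒᵖ M] [AddCommGroup M'] [Module Rᵐᵒᵖ M']
  [AddCommGroup M''] [Module Rᵐᵒᵖ M''] [AddCommGroup N] [Module R N]
  [AddCommGroup N'] [Module R N']

instance : AddCommGroup (Tensor R M N) :=
  inferInstanceAs (AddCommGroup ((M ⊗[ℤ] N) ⧸ balancedRel R M N))

/-- The projection from the tensor product over `ℤ`. -/
def Tensor.proj : (M ⊗[ℤ] N) →+ Tensor R M N :=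
  (Submodule.mkQ (balancedRel R M N)).toAddMonoidHom

/-- The pure tensor `x ⊗ y`. -/
def Tensor.tmul (R : Type u) {M N : Type u} [Ring R] [AddCommGroup M] [Module Rᵐᵒᵖ M]
    [AddCommGroup N] [Module R N] (x : M) (y : N) : Tensor R M N :=
  Tensor.proj (x ⊗ₜ[ℤ] y)

theorem Tensor.smul_tmul (r : R) (x : M) (y : N) :
    Tensor.tmul R (op r • x) y = Tensor.tmul R x (r • y) :=
  (Submodule.Quotient.eq (balancedRel R M N)).2 (Submodule.subset_span ⟨r, x, y, rfl⟩)

theorem Tensor.hom_ext {A : Type*} [AddCommGroup A] {f g : Tensor R M N →+ A}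
    (h : ∀ x y, f (Tensor.tmul R x y) = g (Tensor.tmul R x y)) : f = g := by
  ext t
  obtain ⟨t, rfl⟩ := Submodule.mkQ_surjective (balancedRel R M N) t
  change f (Tensor.proj t) = g (Tensor.proj t)
  induction t with
  | zero => simp
  | tmul x y => exact h x y
  | add a b ha hb => simp only [map_add, ha, hb]

/-- The universal property: a balanced biadditive map induces an additive map on `M ⊗_R N`. -/
def Tensor.lift {A : Type*} [AddCommGroup A] (f : M →+ N →+ A)
    (hf : ∀ (r : R) (x : M) (y : N), f (op r • x) y = f x (r • y)) : Tensor R M N →+ A :=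
  QuotientAddGroup.lift (balancedRel R M N).toAddSubgroup
    (TensorProduct.liftAddHom f fun n x y => by simp) (by
      intro t ht
      refine Submodule.span_induction (p := fun t _ => TensorProduct.liftAddHom f _ t = 0)
        ?_ ?_ ?_ ?_ (show t ∈ balancedRel R M N from ht)
      · rintro _ ⟨r, x, y, rfl⟩
        simp [hf]
      · simp
      · intro a b _ _ ha hb
        simp [ha, hb]
      · intro n a _ ha
        simp [ha])

theorem Tensor.lift_tmul {A : Type*} [AddCommGroup A] (f : M →+ N →+ A)
    (hf : ∀ (r : R) (x : M) (y : N), f (op r • x) y = f x (r • y)) (x : M) (y : N) :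
    Tensor.lift f hf (Tensor.tmul R x y) = f x y := rfl

/-- The additive map `f ⊗ g` for a homomorphism `f` of right `R`-modules and a
homomorphism `g` of left `R`-modules. -/
def Tensor.map (f : M →ₗ[Rᵐᵒᵖ] M') (g : N →ₗ[R] N') : Tensor R M N →+ Tensor R M' N' :=
  (Submodule.mapQ (balancedRel R M N) (balancedRel R M' N')
    (TensorProduct.map f.toAddMonoidHom.toIntLinearMap g.toAddMonoidHom.toIntLinearMap) (by
      refine Submodule.span_le.2 ?_
      rintro _ ⟨r, x, y, rfl⟩
      refine Submodule.subset_span ⟨r, f x, g y, ?_⟩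
      change TensorProduct.map _ _ _ = _
      simp)).toAddMonoidHom

theorem Tensor.map_tmul (f : M →ₗ[Rᵐᵒᵖ] M') (g : N →ₗ[R] N') (x : M) (y : N) :
    Tensor.map f g (Tensor.tmul R x y) = Tensor.tmul R (f x) (g y) := rfl

variable [Module Rᵐᵒᵖ N] [SMulCommClass R Rᵐᵒᵖ N]

/-- Right multiplication by `r` on a bimodule, as a homomorphism of left modules. -/
def rightMul (N : Type u) [AddCommGroup N] [Module R N] [Module Rᵐᵒᵖ N] [SMulCommClass R Rᵐᵒᵖ N]
    (r : Rᵐᵒᵖ) : N →ₗ[R] N where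
  toFun y := r • y
  map_add' := smul_add r
  map_smul' s y := (smul_comm s r y).symm

/-- If `N` is an `R`-`R`-bimodule, `M ⊗_R N` is a right `R`-module via `(x ⊗ y) r = x ⊗ (y r)`. -/
instance : SMul Rᵐᵒᵖ (Tensor R M N) where
  smul r := Tensor.map LinearMap.id (rightMul N r)

theorem Tensor.smul_def (r : Rᵐᵒᵖ) (t : Tensor R M N) :
    r • t = Tensor.map LinearMap.id (rightMul N r) t := rfl

theorem Tensor.op_smul_tmul (r : Rᵐᵒᵖ) (x : M) (y : N) :
    r • Tensor.tmul R x y = Tensor.tmul R x (r • y) := rfl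

theorem Tensor.tmul_add (R : Type u) {M N : Type u} [Ring R] [AddCommGroup M] [Module Rᵐᵒᵖ M]
    [AddCommGroup N] [Module R N] (x : M) (y z : N) :
    Tensor.tmul R x (y + z) = Tensor.tmul R x y + Tensor.tmul R x z := by
  simp [Tensor.tmul, TensorProduct.tmul_add]

theorem Tensor.tmul_zero (R : Type u) {M N : Type u} [Ring R] [AddCommGroup M] [Module Rᵐᵒᵖ M]
    [AddCommGroup N] [Module R N] (x : M) : Tensor.tmul R x (0 : N) = 0 := by
  simp [Tensor.tmul]

instance : Module Rᵐᵒᵖ (Tensor R M N) where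
  one_smul t := DFunLike.congr_fun (Tensor.hom_ext
    (f := Tensor.map LinearMap.id (rightMul N (1 : Rᵐᵒᵖ))) (g := AddMonoidHom.id _)
    fun x y => by simp [← Tensor.smul_def, Tensor.op_smul_tmul]) t
  mul_smul r s t := DFunLike.congr_fun (Tensor.hom_ext
    (f := Tensor.map LinearMap.id (rightMul N (r * s)))
    (g := (Tensor.map LinearMap.id (rightMul N r)).comp (Tensor.map LinearMap.id (rightMul N s)))
    fun x y => by simp [← Tensor.smul_def, Tensor.op_smul_tmul, mul_smul]) t
  smul_zero r := map_zero (Tensor.map LinearMap.id (rightMul N r))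
  smul_add r := map_add (Tensor.map LinearMap.id (rightMul N r))
  add_smul r s t := DFunLike.congr_fun (Tensor.hom_ext
    (f := Tensor.map LinearMap.id (rightMul N (r + s)))
    (g := Tensor.map LinearMap.id (rightMul N r) + Tensor.map LinearMap.id (rightMul N s))
    fun x y => by
      simp [← Tensor.smul_def, Tensor.op_smul_tmul, add_smul, Tensor.tmul_add]) t
  zero_smul t := DFunLike.congr_fun (Tensor.hom_ext
    (f := Tensor.map LinearMap.id (rightMul N (0 : Rᵐᵒᵖ))) (g := 0)
    fun x y => by
      simp [← Tensor.smul_def, Tensor.op_smul_tmul, Tensor.tmul_zero]) t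

/-- `f ⊗ N` as a homomorphism of right `R`-modules, for an `R`-`R`-bimodule `N`. -/
def Tensor.mapRight (N : Type u) [AddCommGroup N] [Module R N] [Module Rᵐᵒᵖ N]
    [SMulCommClass R Rᵐᵒᵖ N] (f : M →ₗ[Rᵐᵒᵖ] M') : Tensor R M N →ₗ[Rᵐᵒᵖ] Tensor R M' N where
  toFun := Tensor.map f LinearMap.id
  map_add' := map_add _
  map_smul' r t := DFunLike.congr_fun (Tensor.hom_ext
    (f := (Tensor.map f LinearMap.id).comp (Tensor.map LinearMap.id (rightMul N r)))
    (g := (Tensor.map LinearMap.id (rightMul N r)).comp (Tensor.map f LinearMap.id))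
    fun _ _ => rfl) t

/-- The functor `- ⊗_R N` on right `R`-modules, for an `R`-`R`-bimodule `N`. -/
def tensorFunctor (R N : Type u) [Ring R] [AddCommGroup N] [Module R N] [Module Rᵐᵒᵖ N]
    [SMulCommClass R Rᵐᵒᵖ N] : ModuleCat.{u} Rᵐᵒᵖ ⥤ ModuleCat.{u} Rᵐᵒᵖ where
  obj M := ModuleCat.of Rᵐᵒᵖ (Tensor R M N)
  map f := ModuleCat.ofHom (Tensor.mapRight N f.hom)
  map_id M := by
    ext t
    exact DFunLike.congr_fun (Tensor.hom_ext
      (f := Tensor.map (LinearMap.id : M →ₗ[Rᵐᵒᵖ] M) (LinearMap.id : N →ₗ[R] N))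
      (g := AddMonoidHom.id _) fun _ _ => rfl) t
  map_comp f g := by
    ext t
    exact DFunLike.congr_fun (Tensor.hom_ext
      (f := Tensor.map (g.hom ∘ₗ f.hom) (LinearMap.id : N →ₗ[R] N))
      (g := (Tensor.map g.hom LinearMap.id).comp (Tensor.map f.hom LinearMap.id))
      fun _ _ => rfl) t

end Tensor

/-- A left `R`-module `N` is flat if `- ⊗_R N` preserves injectivity of homomorphisms of right
`R`-modules. -/
def IsLeftFlat (R N : Type u) [Ring R] [AddCommGroup N] [Module R N] : Prop :=
  ∀ (A B : Type u) [AddCommGroup A] [Module Rᵐᵒᵖ A] [AddCommGroup B] [Module Rᵐᵒᵖ B]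
    (f : A →ₗ[Rᵐᵒᵖ] B), Function.Injective f →
      Function.Injective (Tensor.map f (LinearMap.id : N →ₗ[R] N))

section Hom

/-- `Hom(N_R, M_R)`: the homomorphisms of right `R`-modules. -/
def RHom (R N M : Type u) [Ring R] [AddCommGroup N] [Module Rᵐᵒᵖ N]
    [AddCommGroup M] [Module Rᵐᵒᵖ M] : Type u :=
  N →ₗ[Rᵐᵒᵖ] M

variable {R N M M' : Type u} [Ring R] [AddCommGroup N] [Module R N] [Module Rᵐᵒᵖ N]
  [SMulCommClass R Rᵐᵒᵖ N] [AddCommGroup M] [Module Rᵐᵒᵖ M] [AddCommGroup M'] [Module Rᵐᵒᵖ M']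

instance : AddCommGroup (RHom R N M) := inferInstanceAs (AddCommGroup (N →ₗ[Rᵐᵒᵖ] M))

/-- The identity, from `N →ₗ[Rᵐᵒᵖ] M` to its synonym `RHom R N M`. -/
def RHom.of : (N →ₗ[Rᵐᵒᵖ] M) ≃+ RHom R N M := AddEquiv.refl _

theorem RHom.ext {R N M : Type u} [Ring R] [AddCommGroup N] [Module Rᵐᵒᵖ N] [AddCommGroup M]
    [Module Rᵐᵒᵖ M] {f g : RHom R N M} (h : ∀ y, RHom.of.symm f y = RHom.of.symm g y) : f = g :=
  RHom.of.symm.injective (LinearMap.ext h)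

/-- Left multiplication by `r` on a bimodule, as a homomorphism of right modules. -/
def leftMul (N : Type u) [AddCommGroup N] [Module R N] [Module Rᵐᵒᵖ N] [SMulCommClass R Rᵐᵒᵖ N]
    (r : R) : N →ₗ[Rᵐᵒᵖ] N where
  toFun y := r • y
  map_add' := smul_add r
  map_smul' s y := smul_comm r s y

/-- If `N` is an `R`-`R`-bimodule, `Hom(N_R, M_R)` is a right `R`-module via
`(f r)(y) = f (r y)`. -/
instance : SMul Rᵐᵒᵖ (RHom R N M) where
  smul r f := RHom.of (RHom.of.symm f ∘ₗ leftMul N r.unop)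

theorem RHom.smul_apply (r : Rᵐᵒᵖ) (f : RHom R N M) (y : N) :
    RHom.of.symm (r • f) y = RHom.of.symm f (r.unop • y) := rfl

instance : Module Rᵐᵒᵖ (RHom R N M) where
  one_smul f := RHom.ext fun y => by simp [RHom.smul_apply]
  mul_smul r s f := RHom.ext fun y => by simp [RHom.smul_apply, mul_smul]
  smul_zero r := RHom.ext fun y => by simp [RHom.smul_apply]
  smul_add r f g := RHom.ext fun y => by simp [RHom.smul_apply]
  add_smul r s f := RHom.ext fun y => by simp [RHom.smul_apply, add_smul]
  zero_smul f := RHom.ext fun y => by simp [RHom.smul_apply]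

/-- Composition with `f : M → M'`, as a homomorphism `Hom(N_R, M_R) → Hom(N_R, M'_R)` of right
`R`-modules. -/
def RHom.map (N : Type u) [AddCommGroup N] [Module R N] [Module Rᵐᵒᵖ N]
    [SMulCommClass R Rᵐᵒᵖ N] (f : M →ₗ[Rᵐᵒᵖ] M') : RHom R N M →ₗ[Rᵐᵒᵖ] RHom R N M' where
  toFun g := RHom.of (f ∘ₗ RHom.of.symm g)
  map_add' g h := RHom.ext fun y => by simp
  map_smul' r g := RHom.ext fun y => by simp [RHom.smul_apply]

/-- The functor `Hom(N_R, -)` on right `R`-modules, for an `R`-`R`-bimodule `N`. -/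
def homFunctor (R N : Type u) [Ring R] [AddCommGroup N] [Module R N] [Module Rᵐᵒᵖ N]
    [SMulCommClass R Rᵐᵒᵖ N] : ModuleCat.{u} Rᵐᵒᵖ ⥤ ModuleCat.{u} Rᵐᵒᵖ where
  obj M := ModuleCat.of Rᵐᵒᵖ (RHom R N M)
  map f := ModuleCat.ofHom (RHom.map N f.hom)
  map_id _ := rfl
  map_comp _ _ := rfl

end Hom

section Bimodules

variable {R Q : Type u} [Ring R] [Ring Q]

/-- The ring `Q`, regarded as an `R`-`R`-bimodule through `φ : R → Q`. -/
def QBimod (_φ : R →+* Q) : Type u := Q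

variable (φ : R →+* Q)

instance : AddCommGroup (QBimod φ) := inferInstanceAs (AddCommGroup Q)

/-- The identity, from `Q` to its synonym `QBimod φ`. -/
def QBimod.of : Q ≃+ QBimod φ := AddEquiv.refl Q

/-- `r q = φ(r) q`. -/
instance : SMul R (QBimod φ) where
  smul r q := QBimod.of φ (φ r * (QBimod.of φ).symm q)

/-- `q r = q φ(r)`. -/
instance : SMul Rᵐᵒᵖ (QBimod φ) where
  smul r q := QBimod.of φ ((QBimod.of φ).symm q * φ r.unop)

theorem QBimod.smul_of (r : R) (q : Q) : r • QBimod.of φ q = QBimod.of φ (φ r * q) := rfl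

theorem QBimod.op_smul_of (r : Rᵐᵒᵖ) (q : Q) :
    r • QBimod.of φ q = QBimod.of φ (q * φ r.unop) := rfl

instance : Module R (QBimod φ) where
  one_smul q := by
    obtain ⟨q, rfl⟩ := (QBimod.of φ).surjective q
    simp [QBimod.smul_of]
  mul_smul r s q := by
    obtain ⟨q, rfl⟩ := (QBimod.of φ).surjective q
    simp [QBimod.smul_of, mul_assoc]
  smul_zero r := by rw [← map_zero (QBimod.of φ), QBimod.smul_of, mul_zero]
  smul_add r p q := by
    obtain ⟨p, rfl⟩ := (QBimod.of φ).surjective p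
    obtain ⟨q, rfl⟩ := (QBimod.of φ).surjective q
    simp only [← map_add, QBimod.smul_of, mul_add]
  add_smul r s q := by
    obtain ⟨q, rfl⟩ := (QBimod.of φ).surjective q
    simp [QBimod.smul_of, add_mul]
  zero_smul q := by
    obtain ⟨q, rfl⟩ := (QBimod.of φ).surjective q
    simp [QBimod.smul_of]

instance : Module Rᵐᵒᵖ (QBimod φ) where
  one_smul q := by
    obtain ⟨q, rfl⟩ := (QBimod.of φ).surjective q
    simp [QBimod.op_smul_of]
  mul_smul r s q := by
    obtain ⟨q, rfl⟩ := (QBimod.of φ).surjective q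
    simp [QBimod.op_smul_of, mul_assoc]
  smul_zero r := by rw [← map_zero (QBimod.of φ), QBimod.op_smul_of, zero_mul]
  smul_add r p q := by
    obtain ⟨p, rfl⟩ := (QBimod.of φ).surjective p
    obtain ⟨q, rfl⟩ := (QBimod.of φ).surjective q
    simp only [← map_add, QBimod.op_smul_of, add_mul]
  add_smul r s q := by
    obtain ⟨q, rfl⟩ := (QBimod.of φ).surjective q
    simp [QBimod.op_smul_of, mul_add]
  zero_smul q := by
    obtain ⟨q, rfl⟩ := (QBimod.of φ).surjective q
    simp [QBimod.op_smul_of]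

instance : SMulCommClass R Rᵐᵒᵖ (QBimod φ) where
  smul_comm r s q := by
    obtain ⟨q, rfl⟩ := (QBimod.of φ).surjective q
    simp only [QBimod.smul_of, QBimod.op_smul_of, mul_assoc]

/-- The map `φ` as a homomorphism `R_R → Q_R` of right `R`-modules. -/
def structMap : R →ₗ[Rᵐᵒᵖ] QBimod φ where
  toFun r := QBimod.of φ (φ r)
  map_add' r s := by simp
  map_smul' s r := by simp [QBimod.op_smul_of, MulOpposite.smul_eq_mul_unop]

theorem structMap_apply (r : R) : structMap φ r = QBimod.of φ (φ r) := rfl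

/-- The `R`-`R`-bimodule `K = Q / φ(R)`. -/
def KBimod : Type u := QBimod φ ⧸ LinearMap.range (structMap φ)

instance : AddCommGroup (KBimod φ) :=
  inferInstanceAs (AddCommGroup (QBimod φ ⧸ LinearMap.range (structMap φ)))

instance : Module Rᵐᵒᵖ (KBimod φ) :=
  inferInstanceAs (Module Rᵐᵒᵖ (QBimod φ ⧸ LinearMap.range (structMap φ)))

/-- The canonical projection `Q_R → K_R`. -/
def toK : QBimod φ →ₗ[Rᵐᵒᵖ] KBimod φ := (LinearMap.range (structMap φ)).mkQ

theorem toK_surjective : Function.Surjective (toK φ) :=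
  (LinearMap.range (structMap φ)).mkQ_surjective

/-- Left multiplication by `r` on `K`: the class of `q` goes to the class of `φ(r) q`. -/
instance : SMul R (KBimod φ) where
  smul r := Submodule.mapQ (LinearMap.range (structMap φ)) (LinearMap.range (structMap φ))
    (leftMul (QBimod φ) r) (by
      rintro _ ⟨s, rfl⟩
      exact ⟨r * s, congrArg (QBimod.of φ) (φ.map_mul r s)⟩)

theorem smul_toK (r : R) (q : QBimod φ) : r • toK φ q = toK φ (r • q) := rfl

instance : Module R (KBimod φ) where
  one_smul k := by
    obtain ⟨q, rfl⟩ := toK_surjective φ k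
    rw [smul_toK, one_smul]
  mul_smul r s k := by
    obtain ⟨q, rfl⟩ := toK_surjective φ k
    simp only [smul_toK, mul_smul]
  smul_zero r := by rw [← map_zero (toK φ), smul_toK, smul_zero]
  smul_add r k l := by
    obtain ⟨p, rfl⟩ := toK_surjective φ k
    obtain ⟨q, rfl⟩ := toK_surjective φ l
    rw [← map_add, smul_toK, smul_toK, smul_toK, smul_add, map_add]
  add_smul r s k := by
    obtain ⟨q, rfl⟩ := toK_surjective φ k
    simp only [smul_toK, add_smul, map_add]
  zero_smul k := by
    obtain ⟨q, rfl⟩ := toK_surjective φ k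
    rw [smul_toK, zero_smul, map_zero]

instance : SMulCommClass R Rᵐᵒᵖ (KBimod φ) where
  smul_comm r s k := by
    obtain ⟨q, rfl⟩ := toK_surjective φ k
    rw [← map_smul, smul_toK, smul_toK, smul_comm, map_smul]

/-- The set of all right ideals `I` of `R` with `φ(I)Q = Q`. -/
def gabriel : Set (Submodule Rᵐᵒᵖ R) :=
  {I | Submodule.span Qᵐᵒᵖ (φ '' (I : Set R)) = ⊤}

/-- The topology of right ideals `gabriel φ` has a basis of principal right ideals. -/
def IsOneTopology : Prop :=
  ∀ I ∈ gabriel φ, ∃ s : R, Submodule.span Rᵐᵒᵖ {s} ∈ gabriel φ ∧ Submodule.span Rᵐᵒᵖ {s} ≤ I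

variable (M : Type u) [AddCommGroup M] [Module Rᵐᵒᵖ M]

/-- `M` is torsion if `M ⊗_R Q = 0`. -/
def IsTorsion : Prop := Subsingleton (Tensor R M (QBimod φ))

/-- `M` is torsion-free if its only torsion submodule is zero. -/
def IsTorsionFree : Prop := ∀ N : Submodule Rᵐᵒᵖ M, IsTorsion φ N → N = ⊥

/-- `M` is `h`-divisible if every homomorphism `R_R → M_R` extends to a homomorphism
`Q_R → M_R`. -/
def IsHDivisible : Prop :=
  ∀ g : R →ₗ[Rᵐᵒᵖ] M, ∃ f : QBimod φ →ₗ[Rᵐᵒᵖ] M, f ∘ₗ structMap φ = g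

/-- `M` is `h`-reduced if its only `h`-divisible submodule is zero. -/
def IsHReduced : Prop := ∀ N : Submodule Rᵐᵒᵖ M, IsHDivisible φ N → N = ⊥

/-- `M` is Matlis-cotorsion if `Ext¹_R(Q_R, M_R) = 0`. -/
def IsMatlisCotorsion : Prop :=
  Subsingleton (Abelian.Ext (ModuleCat.of Rᵐᵒᵖ (QBimod φ)) (ModuleCat.of Rᵐᵒᵖ M) 1)

/-- The `h`-reduced torsion-free Matlis-cotorsion right `R`-modules. -/
def catC : ObjectProperty (ModuleCat.{u} Rᵐᵒᵖ) :=
  fun M => IsHReduced φ M ∧ IsTorsionFree φ M ∧ IsMatlisCotorsion φ M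

/-- The `h`-divisible torsion right `R`-modules. -/
def catT : ObjectProperty (ModuleCat.{u} Rᵐᵒᵖ) :=
  fun M => IsHDivisible φ M ∧ IsTorsion φ M

end Bimodules

end Matlis

/-!
The hypotheses make `Q` a ring of right fractions of `R` whose denominators are the elements of
`R` invertible in `Q` (`isRightFractions_of_epi`). Indeed, since `φ` is an epimorphism,
`q ⊗ 1 = 1 ⊗ q` in `Q ⊗_R Q` (`tmul_one_eq_one_tmul`), so `[q] ⊗ 1` vanishes in `K ⊗_R Q`.
By flatness, the annihilator `I` of an element `x` with `x ⊗ 1 = 0` satisfies `IQ = Q`; the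
1-topology gives `s ∈ I` with `sQ = Q`, and direct finiteness makes `s` a unit of `Q`.

From there on the argument is about fractions. A module is torsion if each of its elements is
killed by a denominator, and torsion-free if no nonzero element is. For torsion-free `M` the
sequence `0 → M → M ⊗ Q → M ⊗ K → 0` is exact, and for `h`-divisible `N` so is
`0 → Hom(K, N) → Hom(Q, N) → N → 0`. The middle terms are `Q`-modules. Every extension of `Q` by a
`Q`-module splits (`isMatlisCotorsion_of_bijective`), so `Hom(K, N)` is Matlis-cotorsion because
`Hom(Q, Hom(Q, N)) → Hom(Q, N)` is surjective.

The equivalence is given by the unit `M → Hom(K, M ⊗ K)` and the counit `Hom(K, N) ⊗ K → N` of the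
tensor-hom adjunction. An element of the kernel of the unit is the value at `1` of a
homomorphism `Q → M`, which is zero as `M` is `h`-reduced. The unit is surjective because a map
`K → M ⊗ K` lifts to a map `Q → M ⊗ Q` when `Ext¹(Q, M) = 0`, and the lift is `q ↦ x ⊗ q` with
`x : M`. The counit is handled by writing tensors as `f ⊗ [s⁻¹]` and composing homomorphisms with
left multiplication by `s` or by `s⁻¹`.
-/

namespace Matlis

/-! ### The tensor-hom adjunction for a bimodule -/

section Adjunction

variable {R M N : Type u} [Ring R] [AddCommGroup M] [Module Rᵐᵒᵖ M] [AddCommGroup N]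
  [Module R N]

theorem Tensor.add_tmul (x x' : M) (y : N) :
    Tensor.tmul R (x + x') y = Tensor.tmul R x y + Tensor.tmul R x' y := by
  simp [Tensor.tmul, TensorProduct.add_tmul]

theorem Tensor.zero_tmul (y : N) : Tensor.tmul R (0 : M) y = 0 := by
  simp [Tensor.tmul]

theorem Tensor.induction_on {p : Tensor R M N → Prop} (t : Tensor R M N) (zero : p 0)
    (tmul : ∀ x y, p (Tensor.tmul R x y)) (add : ∀ a b, p a → p b → p (a + b)) : p t := by
  obtain ⟨t, rfl⟩ := Submodule.mkQ_surjective (balancedRel R M N) t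
  change p (Tensor.proj t)
  induction t with
  | zero => simpa using zero
  | tmul x y => exact tmul x y
  | add a b ha hb => rw [map_add]; exact add _ _ ha hb

/-- The biadditive map `(x, y) ↦ x ⊗ y`. -/
def Tensor.mk (R M N : Type u) [Ring R] [AddCommGroup M] [Module Rᵐᵒᵖ M] [AddCommGroup N]
    [Module R N] : M →+ N →+ Tensor R M N :=
  AddMonoidHom.mk' (fun x => AddMonoidHom.mk' (Tensor.tmul R x) (Tensor.tmul_add R x))
    fun x x' => by ext y; exact Tensor.add_tmul x x' y

theorem Tensor.map_surjective {N' : Type u} [AddCommGroup N'] [Module R N'] {g : N →ₗ[R] N'}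
    (hg : Function.Surjective g) :
    Function.Surjective (Tensor.map (LinearMap.id : M →ₗ[Rᵐᵒᵖ] M) g) := by
  intro t
  induction t using Tensor.induction_on with
  | zero => exact ⟨0, map_zero _⟩
  | tmul x y =>
    obtain ⟨z, rfl⟩ := hg y
    exact ⟨Tensor.tmul R x z, rfl⟩
  | add a b ha hb =>
    obtain ⟨a, rfl⟩ := ha
    obtain ⟨b, rfl⟩ := hb
    exact ⟨a + b, map_add _ _ _⟩

variable [Module Rᵐᵒᵖ N] [SMulCommClass R Rᵐᵒᵖ N]

/-- For a bimodule `N` and `x : M`, the homomorphism `y ↦ x ⊗ y` of right modules. -/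
def Tensor.tmulLeft (N : Type u) [AddCommGroup N] [Module R N] [Module Rᵐᵒᵖ N]
    [SMulCommClass R Rᵐᵒᵖ N] (x : M) : N →ₗ[Rᵐᵒᵖ] Tensor R M N where
  toFun := Tensor.tmul R x
  map_add' := Tensor.tmul_add R x
  map_smul' r y := (Tensor.op_smul_tmul r x y).symm

theorem Tensor.tmulLeft_apply (x : M) (y : N) : Tensor.tmulLeft N x y = Tensor.tmul R x y := rfl

/-- The unit `x ↦ (y ↦ x ⊗ y)` of the adjunction between `- ⊗_R N` and `Hom(N_R, -)`. -/
def unitMap (R M N : Type u) [Ring R] [AddCommGroup M] [Module Rᵐᵒᵖ M] [AddCommGroup N]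
    [Module R N] [Module Rᵐᵒᵖ N] [SMulCommClass R Rᵐᵒᵖ N] : M →ₗ[Rᵐᵒᵖ] RHom R N (Tensor R M N) where
  toFun x := RHom.of (Tensor.tmulLeft N x)
  map_add' x x' := RHom.ext fun y => Tensor.add_tmul x x' y
  map_smul' r x := RHom.ext fun y => Tensor.smul_tmul r.unop x y

theorem unitMap_apply (x : M) (y : N) :
    RHom.of.symm (unitMap R M N x) y = Tensor.tmul R x y := rfl

/-- The counit `f ⊗ y ↦ f y` of the adjunction between `- ⊗_R N` and `Hom(N_R, -)`. -/
def counitMap (R M N : Type u) [Ring R] [AddCommGroup M] [Module Rᵐᵒᵖ M] [AddCommGroup N]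
    [Module R N] [Module Rᵐᵒᵖ N] [SMulCommClass R Rᵐᵒᵖ N] : Tensor R (RHom R N M) N →ₗ[Rᵐᵒᵖ] M where
  toFun := Tensor.lift
    (AddMonoidHom.mk' (fun f => (RHom.of.symm f : N →ₗ[Rᵐᵒᵖ] M).toAddMonoidHom) fun _ _ => rfl)
    fun _ _ _ => rfl
  map_add' := map_add _
  map_smul' r t := by
    induction t using Tensor.induction_on with
    | zero => simp
    | tmul f y => exact map_smul (RHom.of.symm f) r y
    | add a b ha hb => simp only [smul_add, map_add, ha, hb]

theorem counitMap_tmul (f : RHom R N M) (y : N) :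
    counitMap R M N (Tensor.tmul R f y) = RHom.of.symm f y := rfl

end Adjunction

/-! ### Flat epimorphisms as rings of right fractions -/

section Fractions

variable {R Q : Type u} [Ring R] [Ring Q]

/-- An additive map between two `Q`-modules which is linear over the source of an epimorphism
`φ : R → Q` is linear over `Q`: otherwise the action of `Q` on the product of the modules and its
conjugate by the shear `(m, n) ↦ (m, n + f m)` would be two extensions of one action of `R`. -/
theorem map_end_of_epi {φ : R →+* Q} (hepi : Epi (RingCat.ofHom φ)) {M N : Type u}
    [AddCommGroup M] [AddCommGroup N] (ρ : Q →+* AddMonoid.End M) (σ : Q →+* AddMonoid.End N)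
    (f : M →+ N) (hf : ∀ r m, f (ρ (φ r) m) = σ (φ r) (f m)) (q : Q) (m : M) :
    f (ρ q m) = σ q (f m) := by
  let α : Q →+* AddMonoid.End (M × N) :=
    { toFun q := AddMonoidHom.prodMap (ρ q) (σ q)
      map_one' := AddMonoidHom.ext fun x => by
        change (ρ 1 x.1, σ 1 x.2) = x
        simp
      map_mul' p q := AddMonoidHom.ext fun x => by
        change (ρ (p * q) x.1, σ (p * q) x.2) = (ρ p (ρ q x.1), σ p (σ q x.2))
        simp
      map_zero' := AddMonoidHom.ext fun x => by
        change (ρ 0 x.1, σ 0 x.2) = 0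
        simp
      map_add' p q := AddMonoidHom.ext fun x => by
        change (ρ (p + q) x.1, σ (p + q) x.2) = (ρ p x.1 + ρ q x.1, σ p x.2 + σ q x.2)
        rw [map_add ρ, map_add σ]
        rfl }
  let β : Q →+* AddMonoid.End (M × N) :=
    { toFun q := AddMonoidHom.mk' (fun x => (ρ q x.1, σ q (x.2 - f x.1) + f (ρ q x.1)))
        fun x y => by
          simp only [Prod.fst_add, Prod.snd_add, map_add, map_sub, Prod.mk_add_mk, Prod.mk.injEq,
            true_and]
          abel
      map_one' := AddMonoidHom.ext fun x => by
        change (ρ 1 x.1, σ 1 (x.2 - f x.1) + f (ρ 1 x.1)) = x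
        simp
      map_mul' p q := AddMonoidHom.ext fun x => by
        change (ρ (p * q) x.1, σ (p * q) (x.2 - f x.1) + f (ρ (p * q) x.1)) =
          (ρ p (ρ q x.1), σ p (σ q (x.2 - f x.1) + f (ρ q x.1) - f (ρ q x.1)) + f (ρ p (ρ q x.1)))
        simp
      map_zero' := AddMonoidHom.ext fun x => by
        change (ρ 0 x.1, σ 0 (x.2 - f x.1) + f (ρ 0 x.1)) = 0
        simp
      map_add' p q := AddMonoidHom.ext fun x => by
        change (ρ (p + q) x.1, σ (p + q) (x.2 - f x.1) + f (ρ (p + q) x.1)) =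
          (ρ p x.1 + ρ q x.1,
            σ p (x.2 - f x.1) + f (ρ p x.1) + (σ q (x.2 - f x.1) + f (ρ q x.1)))
        have hρ : ρ (p + q) x.1 = ρ p x.1 + ρ q x.1 := by rw [map_add ρ]; rfl
        have hσ (y : N) : σ (p + q) y = σ p y + σ q y := by rw [map_add σ]; rfl
        rw [hρ, hσ, map_add f, add_add_add_comm] }
  have h : RingCat.ofHom α = RingCat.ofHom β := by
    rw [← cancel_epi (RingCat.ofHom φ)]
    refine RingCat.hom_ext (RingHom.ext fun r => AddMonoidHom.ext fun x => ?_)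
    change (ρ (φ r) x.1, σ (φ r) x.2) = (ρ (φ r) x.1, σ (φ r) (x.2 - f x.1) + f (ρ (φ r) x.1))
    rw [hf, ← map_add, sub_add_cancel]
  have hq : α q (m, 0) = β q (m, 0) := DFunLike.congr_fun
    (RingHom.congr_fun (congrArg RingCat.Hom.hom h) q) (m, 0)
  have hq' : σ q 0 = σ q (0 - f m) + f (ρ q m) := congrArg Prod.snd hq
  rw [zero_sub, map_zero, map_neg] at hq'
  exact (neg_add_eq_zero.1 hq'.symm).symm

/-- Left multiplication by `q : Q` on `Q`, as a homomorphism of right `R`-modules. -/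
def QBimod.mulLeft (φ : R →+* Q) (q : Q) : QBimod φ →ₗ[Rᵐᵒᵖ] QBimod φ where
  toFun p := QBimod.of φ (q * (QBimod.of φ).symm p)
  map_add' p p' := by rw [map_add, mul_add, map_add]
  map_smul' r p := by
    obtain ⟨p, rfl⟩ := (QBimod.of φ).surjective p
    simp [QBimod.op_smul_of, mul_assoc]

theorem QBimod.mulLeft_of (φ : R →+* Q) (q p : Q) :
    QBimod.mulLeft φ q (QBimod.of φ p) = QBimod.of φ (q * p) := rfl

/-- Right multiplication by `q : Q` on `Q`, as a homomorphism of left `R`-modules. -/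
def QBimod.mulRight (φ : R →+* Q) (q : Q) : QBimod φ →ₗ[R] QBimod φ where
  toFun p := QBimod.of φ ((QBimod.of φ).symm p * q)
  map_add' p p' := by rw [map_add, add_mul, map_add]
  map_smul' r p := by
    obtain ⟨p, rfl⟩ := (QBimod.of φ).surjective p
    simp [QBimod.smul_of, mul_assoc]

/-- For an epimorphism `R → Q`, the element `q ⊗ 1 - 1 ⊗ q` of `Q ⊗_R Q` vanishes. -/
theorem tmul_one_eq_one_tmul {φ : R →+* Q} (hepi : Epi (RingCat.ofHom φ)) (q : Q) :
    Tensor.tmul R (QBimod.of φ q) (QBimod.of φ 1) =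
      Tensor.tmul R (QBimod.of φ 1) (QBimod.of φ q) := by
  let σ : Q →+* AddMonoid.End (Tensor R (QBimod φ) (QBimod φ)) :=
    { toFun q := Tensor.map (QBimod.mulLeft φ q) LinearMap.id
      map_one' := Tensor.hom_ext fun x y => by
        change Tensor.tmul R (QBimod.of φ (1 * (QBimod.of φ).symm x)) y = Tensor.tmul R x y
        simp
      map_mul' p q := Tensor.hom_ext fun x y => by
        change Tensor.tmul R (QBimod.of φ (p * q * (QBimod.of φ).symm x)) y =
          Tensor.tmul R (QBimod.of φ (p * (q * (QBimod.of φ).symm x))) y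
        rw [mul_assoc]
      map_zero' := Tensor.hom_ext fun x y => by
        change Tensor.tmul R (QBimod.of φ (0 * (QBimod.of φ).symm x)) y = 0
        rw [zero_mul, map_zero, Tensor.zero_tmul]
      map_add' p q := Tensor.hom_ext fun x y => by
        change Tensor.tmul R (QBimod.of φ ((p + q) * (QBimod.of φ).symm x)) y =
          Tensor.tmul R (QBimod.of φ (p * (QBimod.of φ).symm x)) y +
            Tensor.tmul R (QBimod.of φ (q * (QBimod.of φ).symm x)) y
        rw [add_mul, map_add, Tensor.add_tmul] }
  let f : Q →+ Tensor R (QBimod φ) (QBimod φ) :=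
    (Tensor.mk R (QBimod φ) (QBimod φ) (QBimod.of φ 1)).comp (QBimod.of φ).toAddMonoidHom
  have h := map_end_of_epi hepi (Module.toAddMonoidEnd Q Q) σ f (fun r m => by
    change Tensor.tmul R (QBimod.of φ 1) (QBimod.of φ (φ r * m)) =
      Tensor.tmul R (QBimod.of φ (φ r * 1)) (QBimod.of φ m)
    rw [← QBimod.smul_of, ← Tensor.smul_tmul, QBimod.op_smul_of, one_mul, mul_one, unop_op]) q 1
  change Tensor.tmul R (QBimod.of φ 1) (QBimod.of φ (q * 1)) =
    Tensor.tmul R (QBimod.of φ (q * 1)) (QBimod.of φ 1) at h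
  rw [mul_one] at h
  exact h.symm

/-- The elements of `R` that become invertible in `Q`. -/
def denominators (φ : R →+* Q) : Submonoid R := (IsUnit.submonoid Q).comap φ

theorem isUnit_of_mem_denominators {φ : R →+* Q} {s : R} (hs : s ∈ denominators φ) :
    IsUnit (φ s) := hs

/-- The homomorphism `r ↦ x r` from `R_R` to a right module `M`. -/
def ofElement (R : Type u) {M : Type u} [Ring R] [AddCommGroup M] [Module Rᵐᵒᵖ M] (x : M) :
    R →ₗ[Rᵐᵒᵖ] M where
  toFun r := op r • x
  map_add' r s := by rw [MulOpposite.op_add, add_smul]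
  map_smul' s r := by simp [MulOpposite.smul_eq_mul_unop, mul_smul]

theorem ofElement_apply {M : Type u} [AddCommGroup M] [Module Rᵐᵒᵖ M] (x : M) (r : R) :
    ofElement R x r = op r • x := rfl

/-- If `1 ⊗ 1` vanishes in `R/I ⊗_R Q`, which is `Q/IQ`, then `IQ = Q`. -/
theorem mem_gabriel_of_tmul_eq_zero (φ : R →+* Q) (I : Submodule Rᵐᵒᵖ R)
    (h : Tensor.tmul R (I.mkQ 1) (QBimod.of φ 1) = 0) : I ∈ gabriel φ := by
  let J : Submodule Qᵐᵒᵖ Q := Submodule.span Qᵐᵒᵖ (φ '' (I : Set R))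
  let g : R →+ QBimod φ →+ Q ⧸ J := AddMonoidHom.mk' (fun r =>
    J.mkQ.toAddMonoidHom.comp
      ((AddMonoidHom.mulLeft (φ r)).comp (QBimod.of φ).symm.toAddMonoidHom)) fun r s => by
        ext q
        change J.mkQ (φ (r + s) * _) = J.mkQ (φ r * _) + J.mkQ (φ s * _)
        rw [map_add, add_mul, map_add]
  have hg (r : R) (q : QBimod φ) : g r q = J.mkQ (φ r * (QBimod.of φ).symm q) := rfl
  let G : (R ⧸ I) →+ QBimod φ →+ Q ⧸ J := QuotientAddGroup.lift I.toAddSubgroup g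
    fun r hr => by
      ext q
      rw [hg]
      refine (Submodule.Quotient.mk_eq_zero J).2 ?_
      exact J.smul_mem (op ((QBimod.of φ).symm q))
        (Submodule.subset_span (Set.mem_image_of_mem φ hr))
  have hG (r : R) (q : QBimod φ) : G (I.mkQ r) q = J.mkQ (φ r * (QBimod.of φ).symm q) := rfl
  let L : Tensor R (R ⧸ I) (QBimod φ) →+ Q ⧸ J := Tensor.lift G fun r x q => by
    obtain ⟨x, rfl⟩ := I.mkQ_surjective x
    obtain ⟨q, rfl⟩ := (QBimod.of φ).surjective q
    rw [← map_smul, hG, hG, MulOpposite.smul_eq_mul_unop, QBimod.smul_of]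
    simp [mul_assoc]
  have h1 : L (Tensor.tmul R (I.mkQ 1) (QBimod.of φ 1)) = J.mkQ (φ 1 * 1) := rfl
  rw [h, map_zero, map_one, mul_one] at h1
  have h2 : (1 : Q) ∈ J := (Submodule.Quotient.mk_eq_zero J).1 h1.symm
  refine (Submodule.eq_top_iff' (p := J)).2 fun q => ?_
  simpa using J.smul_mem (op q) h2

/-- The ring homomorphism `φ : R → Q` exhibits `Q` as a ring of right fractions of `R` with
denominators the elements of `R` invertible in `Q`: each element of `Q` has the form
`φ r * (φ s)⁻¹`, and the kernel of `M → M ⊗_R Q` consists of elements killed by a denominator. -/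
structure IsRightFractions (φ : R →+* Q) : Prop where
  exists_mul_eq : ∀ q : Q, ∃ s ∈ denominators φ, ∃ r : R, q * φ s = φ r
  exists_smul_eq_zero : ∀ (M : Type u) [AddCommGroup M] [Module Rᵐᵒᵖ M] (x : M),
    Tensor.tmul R x (QBimod.of φ 1) = 0 → ∃ s ∈ denominators φ, op s • x = 0

/-- By flatness, the annihilator `I` of an element of the kernel of `M → M ⊗_R Q` satisfies
`IQ = Q`, so `I` contains some `s` with `sQ = Q`, and direct finiteness makes `s` invertible in
`Q`. Applied to the classes in `Q / φ(R)`, this provides the denominators. -/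
theorem isRightFractions_of_epi (φ : R →+* Q) (hepi : Epi (RingCat.ofHom φ))
    (hflat : IsLeftFlat R (QBimod φ)) (hfin : IsDedekindFiniteMonoid Q) (htop : IsOneTopology φ) :
    IsRightFractions φ := by
  have key (M : Type u) [AddCommGroup M] [Module Rᵐᵒᵖ M] (x : M)
      (hx : Tensor.tmul R x (QBimod.of φ 1) = 0) : ∃ s ∈ denominators φ, op s • x = 0 := by
    let I : Submodule Rᵐᵒᵖ R := LinearMap.ker (ofElement R x)
    let ψ : (R ⧸ I) →ₗ[Rᵐᵒᵖ] M := I.liftQ (ofElement R x) le_rfl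
    have hψ : Function.Injective ψ := LinearMap.ker_eq_bot.1 (I.ker_liftQ_eq_bot _ le_rfl le_rfl)
    have hI : I ∈ gabriel φ := by
      refine mem_gabriel_of_tmul_eq_zero φ I (hflat _ _ ψ hψ ?_)
      rw [Tensor.map_tmul, map_zero]
      have : ψ (I.mkQ 1) = x := (I.liftQ_apply _ _).trans (by simp [ofElement_apply])
      rw [this]
      exact hx
    obtain ⟨s, hs, hsI⟩ := htop I hI
    refine ⟨s, ?_, hsI (Submodule.mem_span_singleton_self s)⟩
    have hle : Submodule.span Qᵐᵒᵖ (φ '' (Submodule.span Rᵐᵒᵖ {s} : Set R)) ≤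
        Submodule.span Qᵐᵒᵖ {φ s} := by
      refine Submodule.span_le.2 ?_
      rintro _ ⟨r, hr, rfl⟩
      obtain ⟨a, rfl⟩ := Submodule.mem_span_singleton.1 hr
      refine Submodule.mem_span_singleton.2 ⟨op (φ a.unop), ?_⟩
      simp [MulOpposite.smul_eq_mul_unop]
    have h1 : (1 : Q) ∈ Submodule.span Qᵐᵒᵖ {φ s} := hle (by rw [show _ = _ from hs]; trivial)
    obtain ⟨a, ha⟩ := Submodule.mem_span_singleton.1 h1
    exact IsUnit.of_mul_eq_one a.unop ha
  refine ⟨fun q => ?_, fun M => key M⟩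
  obtain ⟨s, hs, h⟩ := key (KBimod φ) (toK φ (QBimod.of φ q)) (by
    have h := congrArg (Tensor.map (toK φ) LinearMap.id) (tmul_one_eq_one_tmul hepi q)
    rw [Tensor.map_tmul, Tensor.map_tmul] at h
    refine h.trans ?_
    have h1 : toK φ (QBimod.of φ 1) = 0 :=
      (Submodule.Quotient.mk_eq_zero _).2 ⟨1, by rw [structMap_apply, map_one]⟩
    rw [h1, Tensor.zero_tmul])
  rw [← map_smul, QBimod.op_smul_of] at h
  obtain ⟨r, hr⟩ := (Submodule.Quotient.mk_eq_zero _).1 h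
  exact ⟨s, hs, r, hr.symm⟩

end Fractions

section Localization

variable {R Q : Type u} [Ring R] [Ring Q] {φ : R →+* Q}

/-! ### Torsion, and the sequence `0 → M → M ⊗ Q → M ⊗ K → 0` -/

theorem QBimod.exists_smul_eq {s : R} (hs : s ∈ denominators φ) (q : QBimod φ) :
    ∃ p : QBimod φ, s • p = q := by
  obtain ⟨u, hu⟩ := isUnit_of_mem_denominators hs
  obtain ⟨q, rfl⟩ := (QBimod.of φ).surjective q
  exact ⟨QBimod.of φ (↑u⁻¹ * q), by rw [QBimod.smul_of, ← hu, Units.mul_inv_cancel_left]⟩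

theorem QBimod.exists_op_smul_eq {s : R} (hs : s ∈ denominators φ) (q : QBimod φ) :
    ∃ p : QBimod φ, op s • p = q := by
  obtain ⟨u, hu⟩ := isUnit_of_mem_denominators hs
  obtain ⟨q, rfl⟩ := (QBimod.of φ).surjective q
  exact ⟨QBimod.of φ (q * ↑u⁻¹), by
    rw [QBimod.op_smul_of, unop_op, ← hu, Units.inv_mul_cancel_right]⟩

theorem QBimod.eq_zero_of_op_smul_eq_zero {s : R} (hs : s ∈ denominators φ) {q : QBimod φ}
    (h : op s • q = 0) : q = 0 := by
  obtain ⟨q, rfl⟩ := (QBimod.of φ).surjective q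
  rw [QBimod.op_smul_of, map_eq_zero_iff _ (QBimod.of φ).injective, unop_op,
    (isUnit_of_mem_denominators hs).mul_left_eq_zero] at h
  rw [h, map_zero]

/-- Each element of `Q` is a fraction, in bimodule notation. -/
theorem IsRightFractions.exists_op_smul_eq (hφ : IsRightFractions φ) (q : QBimod φ) :
    ∃ s ∈ denominators φ, ∃ r : R, op s • q = QBimod.of φ (φ r) := by
  obtain ⟨q, rfl⟩ := (QBimod.of φ).surjective q
  obtain ⟨s, hs, r, h⟩ := hφ.exists_mul_eq q
  exact ⟨s, hs, r, congrArg (QBimod.of φ) h⟩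

theorem toK_structMap (r : R) : toK φ (QBimod.of φ (φ r)) = 0 :=
  (Submodule.Quotient.mk_eq_zero _).2 ⟨r, rfl⟩

/-- A homomorphism `Q_R → M` vanishing at `1` factors through `K`. -/
def KBimod.lift {M : Type u} [AddCommGroup M] [Module Rᵐᵒᵖ M] (f : QBimod φ →ₗ[Rᵐᵒᵖ] M)
    (hf : f (QBimod.of φ 1) = 0) : KBimod φ →ₗ[Rᵐᵒᵖ] M :=
  (LinearMap.range (structMap φ)).liftQ f (by
    rintro _ ⟨r, rfl⟩
    have h : structMap φ r = op r • QBimod.of φ 1 := by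
      rw [structMap_apply, QBimod.op_smul_of, one_mul, unop_op]
    rw [LinearMap.mem_ker, h, map_smul, hf, smul_zero])

section

variable {M : Type u} [AddCommGroup M] [Module Rᵐᵒᵖ M]

theorem tmul_eq_zero_of_op_smul_eq_zero {s : R} (hs : s ∈ denominators φ) {x : M}
    (hx : op s • x = 0) (q : QBimod φ) : Tensor.tmul R x q = 0 := by
  obtain ⟨p, rfl⟩ := QBimod.exists_smul_eq hs q
  rw [← Tensor.smul_tmul, hx, Tensor.zero_tmul]

theorem IsRightFractions.isTorsion_iff (hφ : IsRightFractions φ) :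
    IsTorsion φ M ↔ ∀ x : M, ∃ s ∈ denominators φ, op s • x = 0 := by
  constructor
  · intro h x
    exact hφ.exists_smul_eq_zero M x (Subsingleton.elim (h := h) _ _)
  · intro h
    refine ⟨fun t t' => ?_⟩
    have h0 : AddMonoidHom.id (Tensor R M (QBimod φ)) = 0 := Tensor.hom_ext fun x q => by
      obtain ⟨s, hs, hx⟩ := h x
      exact tmul_eq_zero_of_op_smul_eq_zero hs hx q
    exact (DFunLike.congr_fun h0 t).trans (DFunLike.congr_fun h0 t').symm

theorem IsRightFractions.isTorsionFree_iff (hφ : IsRightFractions φ) :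
    IsTorsionFree φ M ↔ ∀ s ∈ denominators φ, ∀ x : M, op s • x = 0 → x = 0 := by
  constructor
  · intro h s hs x hx
    refine (Submodule.mem_bot Rᵐᵒᵖ).1 ?_
    rw [← h (Submodule.span Rᵐᵒᵖ {x}) ?_]
    · exact Submodule.mem_span_singleton_self x
    · refine ⟨fun t t' => ?_⟩
      have h0 : AddMonoidHom.id (Tensor R (Submodule.span Rᵐᵒᵖ {x}) (QBimod φ)) = 0 :=
        Tensor.hom_ext fun y q => by
          obtain ⟨y, hy⟩ := y
          obtain ⟨r, rfl⟩ := Submodule.mem_span_singleton.1 hy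
          let x' : Submodule.span Rᵐᵒᵖ {x} := ⟨x, Submodule.mem_span_singleton_self x⟩
          -- The annihilator of `x r` need not contain `s`, so `r` is moved to the other side.
          change Tensor.tmul R (op r.unop • x') q = 0
          rw [Tensor.smul_tmul]
          exact tmul_eq_zero_of_op_smul_eq_zero hs (Subtype.ext hx) _
      exact (DFunLike.congr_fun h0 t).trans (DFunLike.congr_fun h0 t').symm
  · intro h N hN
    refine (Submodule.eq_bot_iff N).2 fun x hx => ?_
    obtain ⟨s, hs, h0⟩ := hφ.isTorsion_iff.1 hN ⟨x, hx⟩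
    exact h s hs x (congrArg Subtype.val h0)

/-- The canonical homomorphism `M → M ⊗_R Q`, `x ↦ x ⊗ 1`. -/
def toTensorQ (φ : R →+* Q) (M : Type u) [AddCommGroup M] [Module Rᵐᵒᵖ M] :
    M →ₗ[Rᵐᵒᵖ] Tensor R M (QBimod φ) where
  toFun x := Tensor.tmul R x (QBimod.of φ 1)
  map_add' x y := Tensor.add_tmul x y _
  map_smul' r x := by
    rw [← op_unop r, Tensor.smul_tmul, QBimod.smul_of, RingHom.id_apply, Tensor.op_smul_tmul,
      QBimod.op_smul_of, one_mul, mul_one, unop_op]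

theorem toTensorQ_apply (x : M) : toTensorQ φ M x = Tensor.tmul R x (QBimod.of φ 1) := rfl

theorem toTensorQ_op_smul (x : M) (r : R) :
    toTensorQ φ M (op r • x) = Tensor.tmul R x (QBimod.of φ (φ r)) := by
  rw [toTensorQ_apply, Tensor.smul_tmul, QBimod.smul_of, mul_one]

theorem IsRightFractions.toTensorQ_injective (hφ : IsRightFractions φ)
    (h : ∀ s ∈ denominators φ, ∀ x : M, op s • x = 0 → x = 0) :
    Function.Injective (toTensorQ φ M) := by
  refine (injective_iff_map_eq_zero _).2 fun x hx => ?_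
  obtain ⟨s, hs, h0⟩ := hφ.exists_smul_eq_zero M x hx
  exact h s hs x h0

/-- The projection `Q → K`, as a homomorphism of left modules. -/
def toKLeft (φ : R →+* Q) : QBimod φ →ₗ[R] KBimod φ where
  toFun := toK φ
  map_add' := map_add _
  map_smul' _ _ := rfl

/-- The homomorphism `M ⊗_R Q → M ⊗_R K` of right modules induced by the projection. -/
def tensorToK (φ : R →+* Q) (M : Type u) [AddCommGroup M] [Module Rᵐᵒᵖ M] :
    Tensor R M (QBimod φ) →ₗ[Rᵐᵒᵖ] Tensor R M (KBimod φ) where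
  toFun := Tensor.map LinearMap.id (toKLeft φ)
  map_add' := map_add _
  map_smul' r t := by
    induction t using Tensor.induction_on with
    | zero => simp
    | tmul x q => exact congrArg (Tensor.tmul R x) (map_smul (toK φ) r q)
    | add a b ha hb => simp only [smul_add, map_add, ha, hb]

theorem tensorToK_tmul (x : M) (q : QBimod φ) :
    tensorToK φ M (Tensor.tmul R x q) = Tensor.tmul R x (toK φ q) := rfl

theorem tensorToK_surjective : Function.Surjective (tensorToK φ M) :=
  Tensor.map_surjective (g := toKLeft φ) (toK_surjective φ)

theorem exact_toTensorQ_tensorToK : Function.Exact (toTensorQ φ M) (tensorToK φ M) := by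
  intro t
  constructor
  · intro ht
    -- The inverse of the map `(M ⊗ Q) / M → M ⊗ K`.
    let P := LinearMap.range (toTensorQ φ M)
    let g (x : M) : KBimod φ →ₗ[Rᵐᵒᵖ] (Tensor R M (QBimod φ) ⧸ P) :=
      Submodule.mapQ (LinearMap.range (structMap φ)) P (Tensor.tmulLeft (QBimod φ) x) (by
        rintro _ ⟨r, rfl⟩
        exact ⟨op r • x, toTensorQ_op_smul x r⟩)
    have hg (x : M) (q : QBimod φ) : g x (toK φ q) = P.mkQ (Tensor.tmul R x q) := rfl
    let L : Tensor R M (KBimod φ) →+ Tensor R M (QBimod φ) ⧸ P :=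
      Tensor.lift (AddMonoidHom.mk' (fun x => (g x).toAddMonoidHom) fun x y => by
        ext k
        obtain ⟨q, rfl⟩ := toK_surjective φ k
        change g (x + y) (toK φ q) = g x (toK φ q) + g y (toK φ q)
        rw [hg, hg, hg, Tensor.add_tmul, map_add]) fun r x k => by
        obtain ⟨q, rfl⟩ := toK_surjective φ k
        change g (op r • x) (toK φ q) = g x (r • toK φ q)
        rw [smul_toK, hg, hg, Tensor.smul_tmul]
    have hL : L.comp (tensorToK φ M).toAddMonoidHom = P.mkQ.toAddMonoidHom :=
      Tensor.hom_ext fun _ _ => rfl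
    have h0 : L (tensorToK φ M t) = P.mkQ t := DFunLike.congr_fun hL t
    rw [ht, map_zero] at h0
    exact (Submodule.Quotient.mk_eq_zero P).1 h0.symm
  · rintro ⟨x, rfl⟩
    rw [toTensorQ_apply, tensorToK_tmul, ← map_one φ, toK_structMap, Tensor.tmul_zero]

theorem tensorQ_eq_zero_of_op_smul_eq_zero {s : R} (hs : s ∈ denominators φ)
    {t : Tensor R M (QBimod φ)} (ht : op s • t = 0) : t = 0 := by
  obtain ⟨u, hu⟩ := isUnit_of_mem_denominators hs
  have h : (Tensor.map LinearMap.id (QBimod.mulRight φ ↑u⁻¹)).comp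
      (Tensor.map LinearMap.id (rightMul (QBimod φ) (op s))) =
        AddMonoidHom.id (Tensor R M (QBimod φ)) := Tensor.hom_ext fun x q => by
    obtain ⟨q, rfl⟩ := (QBimod.of φ).surjective q
    change Tensor.tmul R x (QBimod.of φ (q * φ s * ↑u⁻¹)) = Tensor.tmul R x (QBimod.of φ q)
    rw [← hu, Units.mul_inv_cancel_right]
  have h' : Tensor.map LinearMap.id (QBimod.mulRight φ ↑u⁻¹) (op s • t) = t :=
    DFunLike.congr_fun h t
  rw [← h', ht, map_zero]

/-! ### Homomorphisms out of `Q` -/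

/-- If `M` embeds in `M ⊗_R Q` and `x ⊗ Q` lies in the image of `M`, then `q ↦ x ⊗ q` is a
homomorphism `Q → M`. -/
theorem exists_hom_of_tmul_mem_range (hinj : Function.Injective (toTensorQ φ M)) (x : M)
    (hx : ∀ q, Tensor.tmul R x q ∈ LinearMap.range (toTensorQ φ M)) :
    ∃ f : QBimod φ →ₗ[Rᵐᵒᵖ] M, f (QBimod.of φ 1) = x := by
  refine ⟨(LinearEquiv.ofInjective _ hinj).symm.toLinearMap ∘ₗ
    (Tensor.tmulLeft (QBimod φ) x).codRestrict _ hx, ?_⟩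
  change (LinearEquiv.ofInjective _ hinj).symm _ = x
  rw [LinearEquiv.symm_apply_eq]
  rfl

/-- If the denominators act bijectively on `M`, then `M` is a `Q`-module, so that each of its
elements is the value at `1` of a homomorphism from `Q`. -/
theorem IsRightFractions.exists_hom_of_bijective (hφ : IsRightFractions φ)
    (hinj : ∀ s ∈ denominators φ, ∀ x : M, op s • x = 0 → x = 0)
    (hsurj : ∀ s ∈ denominators φ, ∀ x : M, ∃ y, op s • y = x) (x : M) :
    ∃ f : QBimod φ →ₗ[Rᵐᵒᵖ] M, f (QBimod.of φ 1) = x := by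
  refine exists_hom_of_tmul_mem_range (hφ.toTensorQ_injective hinj) x fun q => ?_
  obtain ⟨s, hs, r, h⟩ := hφ.exists_op_smul_eq q
  obtain ⟨y, hy⟩ := hsurj s hs (op r • x)
  refine ⟨y, sub_eq_zero.1 (tensorQ_eq_zero_of_op_smul_eq_zero hs ?_)⟩
  rw [smul_sub, ← map_smul, hy, toTensorQ_op_smul, Tensor.op_smul_tmul, h, sub_self]

/-- A homomorphism from `Q` to a torsion-free module is determined by its value at `1`. -/
theorem IsRightFractions.hom_ext (hφ : IsRightFractions φ)
    (hM : ∀ s ∈ denominators φ, ∀ x : M, op s • x = 0 → x = 0) {f g : QBimod φ →ₗ[Rᵐᵒᵖ] M}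
    (h : f (QBimod.of φ 1) = g (QBimod.of φ 1)) : f = g := by
  refine LinearMap.ext fun q => sub_eq_zero.1 ?_
  obtain ⟨s, hs, r, hr⟩ := hφ.exists_op_smul_eq q
  refine hM s hs _ ?_
  have h1 : op s • q = op r • QBimod.of φ 1 := by
    rw [hr, QBimod.op_smul_of, one_mul, unop_op]
  rw [smul_sub, ← map_smul, ← map_smul, h1, map_smul, map_smul, h, sub_self]

theorem isHDivisible_iff :
    IsHDivisible φ M ↔ ∀ x : M, ∃ f : QBimod φ →ₗ[Rᵐᵒᵖ] M, f (QBimod.of φ 1) = x := by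
  constructor
  · intro h x
    obtain ⟨f, hf⟩ := h (ofElement R x)
    refine ⟨f, ?_⟩
    have := LinearMap.congr_fun hf 1
    rwa [LinearMap.comp_apply, structMap_apply, map_one, ofElement_apply, op_one, one_smul] at this
  · intro h g
    obtain ⟨f, hf⟩ := h (g 1)
    refine ⟨f, LinearMap.ext fun r => ?_⟩
    have h1 : structMap φ r = op r • QBimod.of φ 1 := by
      rw [structMap_apply, QBimod.op_smul_of, one_mul, unop_op]
    rw [LinearMap.comp_apply, h1, map_smul, hf, ← map_smul, MulOpposite.smul_eq_mul_unop,
      unop_op, one_mul]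

/-- Images of `Q` are `h`-divisible, so an `h`-reduced module receives no nonzero homomorphism
from `Q`. -/
theorem IsHReduced.hom_eq_zero (hM : IsHReduced φ M) (f : QBimod φ →ₗ[Rᵐᵒᵖ] M) : f = 0 := by
  refine LinearMap.range_eq_bot.1 (hM _ (isHDivisible_iff.2 ?_))
  rintro ⟨_, q, rfl⟩
  refine ⟨f.rangeRestrict ∘ₗ QBimod.mulLeft φ ((QBimod.of φ).symm q), Subtype.ext ?_⟩
  change f (QBimod.of φ ((QBimod.of φ).symm q * 1)) = f q
  rw [mul_one, AddEquiv.apply_symm_apply]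

theorem isHReduced_of_hom_eq_zero (h : ∀ f : QBimod φ →ₗ[Rᵐᵒᵖ] M, f = 0) : IsHReduced φ M := by
  intro N hN
  refine (Submodule.eq_bot_iff N).2 fun x hx => ?_
  obtain ⟨f, hf⟩ := isHDivisible_iff.1 hN ⟨x, hx⟩
  have h1 := LinearMap.congr_fun (h (N.subtype ∘ₗ f)) (QBimod.of φ 1)
  rwa [LinearMap.comp_apply, hf] at h1

end

/-! ### Extensions of `Q` -/

section Ext

variable {A B C : Type u} [AddCommGroup A] [Module Rᵐᵒᵖ A] [AddCommGroup B] [Module Rᵐᵒᵖ B]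
  [AddCommGroup C] [Module Rᵐᵒᵖ C] {i : A →ₗ[Rᵐᵒᵖ] B} {p : B →ₗ[Rᵐᵒᵖ] C}

theorem IsMatlisCotorsion.exists_lift (hA : IsMatlisCotorsion φ A) (hi : Function.Injective i)
    (hip : Function.Exact i p) (hp : Function.Surjective p) (f : QBimod φ →ₗ[Rᵐᵒᵖ] C) :
    ∃ g : QBimod φ →ₗ[Rᵐᵒᵖ] B, p ∘ₗ g = f := by
  have hS := ModuleCat.shortComplex_shortExact
    (ModuleCat.shortComplexOfCompEqZero i p hip.linearMap_comp_eq_zero) hip hi hp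
  obtain ⟨x, hx⟩ := Abelian.Ext.covariant_sequence_exact₃
    (ModuleCat.of Rᵐᵒᵖ (QBimod φ)) hS (Abelian.Ext.mk₀ (ModuleCat.ofHom f)) (zero_add 1)
    (Subsingleton.elim (h := hA) _ _)
  obtain ⟨g, rfl⟩ := Abelian.Ext.addEquiv₀.symm.surjective x
  refine ⟨g.hom, ?_⟩
  rw [Abelian.Ext.addEquiv₀_symm_apply, Abelian.Ext.mk₀_comp_mk₀] at hx
  exact congrArg ModuleCat.Hom.hom ((Abelian.Ext.mk₀_bijective _ _).1 hx)

theorem IsMatlisCotorsion.of_exists_lift (hB : IsMatlisCotorsion φ B)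
    (hi : Function.Injective i) (hip : Function.Exact i p) (hp : Function.Surjective p)
    (h : ∀ f : QBimod φ →ₗ[Rᵐᵒᵖ] C, ∃ g : QBimod φ →ₗ[Rᵐᵒᵖ] B, p ∘ₗ g = f) :
    IsMatlisCotorsion φ A := by
  have hS := ModuleCat.shortComplex_shortExact
    (ModuleCat.shortComplexOfCompEqZero i p hip.linearMap_comp_eq_zero) hip hi hp
  refine subsingleton_of_forall_eq 0 fun e => ?_
  obtain ⟨x, rfl⟩ := Abelian.Ext.covariant_sequence_exact₁
    (ModuleCat.of Rᵐᵒᵖ (QBimod φ)) hS e (Subsingleton.elim (h := hB) _ _) (zero_add 1)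
  obtain ⟨f, rfl⟩ := Abelian.Ext.addEquiv₀.symm.surjective x
  obtain ⟨g, hg⟩ := h f.hom
  have hf : f = ModuleCat.ofHom g ≫ ModuleCat.ofHom p := by
    rw [← ModuleCat.ofHom_comp, hg, ModuleCat.ofHom_hom]
  rw [Abelian.Ext.addEquiv₀_symm_apply, hf, ← Abelian.Ext.mk₀_comp_mk₀,
    Abelian.Ext.comp_assoc_of_second_deg_zero]
  rw [show (Abelian.Ext.mk₀ (ModuleCat.ofHom p)).comp hS.extClass (zero_add 1) = 0 from
    hS.comp_extClass, Abelian.Ext.comp_zero]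

/-- A module on which the denominators act bijectively is Matlis-cotorsion: any extension of `Q`
by it is again a `Q`-module, so that it splits. -/
theorem IsRightFractions.isMatlisCotorsion_of_bijective (hφ : IsRightFractions φ)
    (hinj : ∀ s ∈ denominators φ, ∀ x : A, op s • x = 0 → x = 0)
    (hsurj : ∀ s ∈ denominators φ, ∀ x : A, ∃ y, op s • y = x) : IsMatlisCotorsion φ A := by
  let J := Injective.under (ModuleCat.of Rᵐᵒᵖ A)
  let j : A →ₗ[Rᵐᵒᵖ] J := (Injective.ι (ModuleCat.of Rᵐᵒᵖ A)).hom
  have hj : Function.Injective j := (ModuleCat.mono_iff_injective _).1 (Injective.ι_mono _)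
  have hJ : IsMatlisCotorsion φ J :=
    Abelian.Ext.subsingleton_of_injective (ModuleCat.of Rᵐᵒᵖ (QBimod φ)) J 0
  let p := (LinearMap.range j).mkQ
  have hjp : Function.Exact j p := LinearMap.exact_map_mkQ_range j
  refine hJ.of_exists_lift hj hjp (Submodule.mkQ_surjective _) fun f => ?_
  -- The pullback of `J → J / A` along `f`, an extension of `Q` by `A`.
  let E : Submodule Rᵐᵒᵖ (J × QBimod φ) :=
    LinearMap.eqLocus (p ∘ₗ LinearMap.fst _ _ _) (f ∘ₗ LinearMap.snd _ _ _)
  have hE (z : J × QBimod φ) : z ∈ E ↔ p z.1 = f z.2 := Iff.rfl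
  have hE1 : ∀ s ∈ denominators φ, ∀ z : E, op s • z = 0 → z = 0 := by
    rintro s hs ⟨⟨y, q⟩, hz⟩ h0
    have h1 : op s • y = 0 := congrArg (fun z : E => z.1.1) h0
    have h2 : op s • q = 0 := congrArg (fun z : E => z.1.2) h0
    obtain rfl := QBimod.eq_zero_of_op_smul_eq_zero hs h2
    rw [hE, map_zero] at hz
    obtain ⟨a, rfl⟩ := (hjp y).1 hz
    rw [← map_smul] at h1
    obtain rfl := hinj s hs a (hj (h1.trans (map_zero j).symm))
    exact Subtype.ext (Prod.ext (map_zero j) rfl)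
  have hE2 : ∀ s ∈ denominators φ, ∀ z : E, ∃ w, op s • w = z := by
    rintro s hs ⟨⟨y, q⟩, hz⟩
    obtain ⟨q, rfl⟩ := QBimod.exists_op_smul_eq hs q
    obtain ⟨y', hy'⟩ := Submodule.mkQ_surjective _ (f q)
    rw [hE, map_smul, ← hy', ← map_smul] at hz
    obtain ⟨a, ha⟩ := (hjp (y - op s • y')).1 (by rw [map_sub, sub_eq_zero]; exact hz)
    obtain ⟨b, rfl⟩ := hsurj s hs a
    refine ⟨⟨(j b + y', q), ?_⟩, Subtype.ext (Prod.ext ?_ rfl)⟩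
    · rw [hE, map_add, (hjp _).2 ⟨b, rfl⟩, zero_add]
      exact hy'
    · change op s • (j b + y') = y
      rw [smul_add, ← map_smul, ha, sub_add_cancel]
  obtain ⟨y, hy⟩ := Submodule.mkQ_surjective _ (f (QBimod.of φ 1))
  obtain ⟨g, hg⟩ := hφ.exists_hom_of_bijective (M := E) hE1 hE2 ⟨(y, QBimod.of φ 1), hy⟩
  have hsnd : LinearMap.snd _ _ _ ∘ₗ E.subtype ∘ₗ g = LinearMap.id :=
    hφ.hom_ext (fun s hs q => QBimod.eq_zero_of_op_smul_eq_zero hs)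
      (congrArg (fun z : E => z.1.2) hg)
  refine ⟨LinearMap.fst _ _ _ ∘ₗ E.subtype ∘ₗ g, LinearMap.ext fun q => ?_⟩
  exact ((hE _).1 (g q).2).trans (congrArg f (LinearMap.congr_fun hsnd q))

end Ext

end Localization

section Equivalence

variable {R Q : Type u} [Ring R] [Ring Q] {φ : R →+* Q} {M N : Type u}
  [AddCommGroup M] [Module Rᵐᵒᵖ M] [AddCommGroup N] [Module Rᵐᵒᵖ N]

/-! ### The values of the functors -/

theorem KBimod.exists_smul_eq {s : R} (hs : s ∈ denominators φ) (k : KBimod φ) :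
    ∃ l : KBimod φ, s • l = k := by
  obtain ⟨q, rfl⟩ := toK_surjective φ k
  obtain ⟨p, rfl⟩ := QBimod.exists_smul_eq hs q
  exact ⟨toK φ p, smul_toK φ s p⟩

theorem IsRightFractions.exists_op_smul_toK_eq_zero (hφ : IsRightFractions φ) (k : KBimod φ) :
    ∃ s ∈ denominators φ, op s • k = 0 := by
  obtain ⟨q, rfl⟩ := toK_surjective φ k
  obtain ⟨s, hs, r, h⟩ := hφ.exists_op_smul_eq q
  exact ⟨s, hs, by rw [← map_smul, h, toK_structMap]⟩

theorem IsRightFractions.isTorsion_tensor (hφ : IsRightFractions φ) :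
    IsTorsion φ (Tensor R M (KBimod φ)) := by
  have h0 (q : QBimod φ) (t : Tensor R M (KBimod φ)) : Tensor.tmul R t q = 0 := by
    induction t using Tensor.induction_on with
    | zero => exact Tensor.zero_tmul q
    | tmul x k =>
      obtain ⟨s, hs, h⟩ := hφ.exists_op_smul_toK_eq_zero k
      refine tmul_eq_zero_of_op_smul_eq_zero hs ?_ q
      rw [Tensor.op_smul_tmul, h, Tensor.tmul_zero]
    | add a b ha hb => rw [Tensor.add_tmul, ha, hb, add_zero]
  have h1 : AddMonoidHom.id (Tensor R (Tensor R M (KBimod φ)) (QBimod φ)) = 0 :=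
    Tensor.hom_ext fun t q => h0 q t
  exact ⟨fun t t' => (DFunLike.congr_fun h1 t).trans (DFunLike.congr_fun h1 t').symm⟩

theorem isHDivisible_tensor : IsHDivisible φ (Tensor R M (KBimod φ)) := by
  refine isHDivisible_iff.2 fun t => ?_
  induction t using Tensor.induction_on with
  | zero => exact ⟨0, rfl⟩
  | tmul x k =>
    obtain ⟨q, rfl⟩ := toK_surjective φ k
    refine ⟨Tensor.tmulLeft (KBimod φ) x ∘ₗ toK φ ∘ₗ
      QBimod.mulLeft φ ((QBimod.of φ).symm q), ?_⟩
    change Tensor.tmul R x (toK φ (QBimod.of φ ((QBimod.of φ).symm q * 1))) = _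
    rw [mul_one, AddEquiv.apply_symm_apply]
  | add a b ha hb =>
    obtain ⟨f, rfl⟩ := ha
    obtain ⟨g, rfl⟩ := hb
    exact ⟨f + g, rfl⟩

/-- `Hom(Q, Hom(K, N)) = Hom(Q ⊗ K, N)` vanishes because `Q ⊗_R K = 0`: for `p = r s⁻¹`,
the tensor `q ⊗ [p]` equals `q p ⊗ [1]`. -/
theorem IsRightFractions.isHReduced_hom (hφ : IsRightFractions φ) :
    IsHReduced φ (RHom R (KBimod φ) N) := by
  refine isHReduced_of_hom_eq_zero fun f => LinearMap.ext fun q => RHom.ext fun k => ?_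
  have hmove (r : R) (q : QBimod φ) (k : KBimod φ) :
      RHom.of.symm (f (op r • q)) k = RHom.of.symm (f q) (r • k) := by
    rw [map_smul]
    rfl
  obtain ⟨p, rfl⟩ := toK_surjective φ k
  obtain ⟨s, hs, r, h⟩ := hφ.exists_op_smul_eq p
  obtain ⟨u, hu⟩ := isUnit_of_mem_denominators hs
  have hp : p = r • QBimod.of φ ↑u⁻¹ := by
    obtain ⟨p, rfl⟩ := (QBimod.of φ).surjective p
    rw [QBimod.op_smul_of] at h
    have h := (QBimod.of φ).injective h
    rw [unop_op, ← hu] at h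
    rw [QBimod.smul_of, ← h, Units.mul_inv_cancel_right]
  obtain ⟨q', hq'⟩ := QBimod.exists_op_smul_eq hs (op r • q)
  have hone : s • QBimod.of φ ↑u⁻¹ = QBimod.of φ (φ 1) := by
    rw [QBimod.smul_of, ← hu, Units.mul_inv, map_one φ]
  rw [hp, ← smul_toK, ← hmove, ← hq', hmove, smul_toK, hone, toK_structMap, map_zero]
  rfl

theorem IsRightFractions.isTorsionFree_hom (hφ : IsRightFractions φ) :
    IsTorsionFree φ (RHom R (KBimod φ) N) := by
  refine hφ.isTorsionFree_iff.2 fun s hs f hf => RHom.ext fun k => ?_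
  obtain ⟨l, rfl⟩ := KBimod.exists_smul_eq hs k
  exact DFunLike.congr_fun (congrArg RHom.of.symm hf) l

/-- The sequence `0 → Hom(K, N) → Hom(Q, N) → N → 0` is exact for `h`-divisible `N`, its middle
term is a `Q`-module, and a homomorphism `f : Q → N` lifts to `q ↦ (p ↦ f (q p))`. -/
theorem IsRightFractions.isMatlisCotorsion_hom (hφ : IsRightFractions φ)
    (hN : IsHDivisible φ N) : IsMatlisCotorsion φ (RHom R (KBimod φ) N) := by
  let i : RHom R (KBimod φ) N →ₗ[Rᵐᵒᵖ] RHom R (QBimod φ) N :=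
    { toFun f := RHom.of (RHom.of.symm f ∘ₗ toK φ)
      map_add' _ _ := rfl
      map_smul' _ _ := rfl }
  let p : RHom R (QBimod φ) N →ₗ[Rᵐᵒᵖ] N :=
    { toFun f := RHom.of.symm f (QBimod.of φ 1)
      map_add' _ _ := rfl
      map_smul' r f := by
        rw [RHom.smul_apply, QBimod.smul_of, mul_one, RingHom.id_apply, ← map_smul,
          QBimod.op_smul_of, one_mul] }
  have hi : Function.Injective i := fun f g h => RHom.ext fun k => by
    obtain ⟨q, rfl⟩ := toK_surjective φ k
    exact DFunLike.congr_fun (congrArg RHom.of.symm h) q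
  have hip : Function.Exact i p := fun f => by
    constructor
    · intro hf
      exact ⟨RHom.of (KBimod.lift (RHom.of.symm f) hf), rfl⟩
    · rintro ⟨f, rfl⟩
      change RHom.of.symm f (toK φ (QBimod.of φ 1)) = 0
      rw [← map_one φ, toK_structMap, map_zero]
  have hp : Function.Surjective p := fun x => by
    obtain ⟨f, hf⟩ := isHDivisible_iff.1 hN x
    exact ⟨RHom.of f, hf⟩
  have hmid : IsMatlisCotorsion φ (RHom R (QBimod φ) N) := by
    refine hφ.isMatlisCotorsion_of_bijective (fun s hs f hf => RHom.ext fun q => ?_)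
      fun s hs f => ?_
    · obtain ⟨q, rfl⟩ := QBimod.exists_smul_eq hs q
      exact DFunLike.congr_fun (congrArg RHom.of.symm hf) q
    · obtain ⟨u, hu⟩ := isUnit_of_mem_denominators hs
      refine ⟨RHom.of (RHom.of.symm f ∘ₗ QBimod.mulLeft φ ↑u⁻¹), RHom.ext fun q => ?_⟩
      obtain ⟨q, rfl⟩ := (QBimod.of φ).surjective q
      change RHom.of.symm f (QBimod.of φ (↑u⁻¹ * (φ s * q))) = _
      rw [← hu, Units.inv_mul_cancel_left]
  refine hmid.of_exists_lift hi hip hp fun f => ?_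
  refine ⟨{ toFun q := RHom.of (f ∘ₗ QBimod.mulLeft φ ((QBimod.of φ).symm q))
            map_add' q q' := RHom.ext fun x => ?_
            map_smul' r q := RHom.ext fun x => ?_ }, LinearMap.ext fun q => ?_⟩
  · change f (QBimod.of φ ((QBimod.of φ).symm (q + q') * (QBimod.of φ).symm x)) =
      f (QBimod.of φ ((QBimod.of φ).symm q * (QBimod.of φ).symm x)) +
        f (QBimod.of φ ((QBimod.of φ).symm q' * (QBimod.of φ).symm x))
    rw [map_add, add_mul, map_add, map_add]
  · change f (QBimod.of φ ((QBimod.of φ).symm q * φ r.unop * (QBimod.of φ).symm x)) =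
      f (QBimod.of φ ((QBimod.of φ).symm q * (φ r.unop * (QBimod.of φ).symm x)))
    rw [mul_assoc]
  · change f (QBimod.of φ ((QBimod.of φ).symm q * 1)) = f q
    rw [mul_one, AddEquiv.apply_symm_apply]

/-! ### The unit and the counit are isomorphisms -/

/-- If `x ⊗ K = 0`, then `x ⊗ Q` lies in `M`, which yields a homomorphism `Q → M` with value `x`
at `1`. -/
theorem IsRightFractions.unitMap_injective (hφ : IsRightFractions φ) (hred : IsHReduced φ M)
    (hM : IsTorsionFree φ M) : Function.Injective (unitMap R M (KBimod φ)) := by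
  refine (injective_iff_map_eq_zero _).2 fun x hx => ?_
  obtain ⟨f, rfl⟩ := exists_hom_of_tmul_mem_range
    (hφ.toTensorQ_injective (hφ.isTorsionFree_iff.1 hM)) x fun q =>
      (exact_toTensorQ_tensorToK _).1 (DFunLike.congr_fun (congrArg RHom.of.symm hx) (toK φ q))
  rw [hred.hom_eq_zero f, LinearMap.zero_apply]

/-- A homomorphism `K → M ⊗ K` lifts to `g : Q → M ⊗ Q` because `M` is Matlis-cotorsion. The
element `g 1` comes from some `x : M`, whence `g q = x ⊗ q`. -/
theorem IsRightFractions.unitMap_surjective (hφ : IsRightFractions φ) (hM : IsTorsionFree φ M)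
    (hcot : IsMatlisCotorsion φ M) : Function.Surjective (unitMap R M (KBimod φ)) := by
  intro f
  obtain ⟨g, hg⟩ := hcot.exists_lift (hφ.toTensorQ_injective (hφ.isTorsionFree_iff.1 hM))
    exact_toTensorQ_tensorToK tensorToK_surjective (RHom.of.symm f ∘ₗ toK φ)
  have hg' (q : QBimod φ) : tensorToK φ M (g q) = RHom.of.symm f (toK φ q) :=
    LinearMap.congr_fun hg q
  obtain ⟨x, hx⟩ := (exact_toTensorQ_tensorToK (g (QBimod.of φ 1))).1
    (by rw [hg', ← map_one φ, toK_structMap, map_zero])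
  have hgx : Tensor.tmulLeft (QBimod φ) x = g :=
    hφ.hom_ext (fun s hs t => tensorQ_eq_zero_of_op_smul_eq_zero hs) hx
  refine ⟨x, RHom.ext fun k => ?_⟩
  obtain ⟨q, rfl⟩ := toK_surjective φ k
  rw [unitMap_apply, ← hg', ← hgx, Tensor.tmulLeft_apply, tensorToK_tmul]

/-- By reduction to a common denominator, each element of `M ⊗ K` has the form `x ⊗ [s⁻¹]`. -/
theorem IsRightFractions.exists_tmul_toK_eq (hφ : IsRightFractions φ) (t : Tensor R M (KBimod φ)) :
    ∃ (u : Qˣ) (x : M), (∃ s : R, φ s = u) ∧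
      t = Tensor.tmul R x (toK φ (QBimod.of φ ↑u⁻¹)) := by
  have hfrac (q : Q) : ∃ (u : Qˣ) (r : R), (∃ s : R, φ s = u) ∧ q = φ r * ↑u⁻¹ := by
    obtain ⟨s, ⟨u, hu⟩, r, h⟩ := hφ.exists_mul_eq q
    refine ⟨u, r, ⟨s, hu.symm⟩, ?_⟩
    rw [← h, show φ s = u from hu.symm, Units.mul_inv_cancel_right]
  have hmul (x : M) (r : R) (q : Q) : Tensor.tmul R x (toK φ (QBimod.of φ (φ r * q))) =
      Tensor.tmul R (op r • x) (toK φ (QBimod.of φ q)) := by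
    rw [Tensor.smul_tmul, smul_toK, QBimod.smul_of]
  induction t using Tensor.induction_on with
  | zero => exact ⟨1, 0, ⟨1, map_one φ⟩, (Tensor.zero_tmul _).symm⟩
  | tmul x k =>
    obtain ⟨q, rfl⟩ := toK_surjective φ k
    obtain ⟨q, rfl⟩ := (QBimod.of φ).surjective q
    obtain ⟨u, r, hu, rfl⟩ := hfrac q
    exact ⟨u, op r • x, hu, hmul x r _⟩
  | add a b ha hb =>
    obtain ⟨u, x, ⟨s, hs⟩, rfl⟩ := ha
    obtain ⟨v, y, ⟨t, ht⟩, rfl⟩ := hb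
    -- Write `u⁻¹ v = r w⁻¹`, so that `u⁻¹ = r (v w)⁻¹` and `v⁻¹ = w (v w)⁻¹`.
    obtain ⟨w, r, ⟨c, hc⟩, h⟩ := hfrac (↑u⁻¹ * ↑v)
    have hu : (↑u⁻¹ : Q) = φ r * ↑(v * w)⁻¹ := by
      rw [mul_inv_rev, Units.val_mul, ← mul_assoc, ← h, Units.mul_inv_cancel_right]
    have hv : (↑v⁻¹ : Q) = φ c * ↑(v * w)⁻¹ := by
      rw [hc, mul_inv_rev, Units.val_mul, Units.mul_inv_cancel_left]
    refine ⟨v * w, op r • x + op c • y, ⟨t * c, ?_⟩, ?_⟩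
    · rw [map_mul, ht, hc, Units.val_mul]
    · rw [hu, hv, hmul, hmul, Tensor.add_tmul]

/-- If `f ⊗ [s⁻¹]` goes to `f [s⁻¹] = 0`, then `g [q] = f [s⁻¹ q]` is well defined on `K`, and
`f ⊗ [s⁻¹] = g s ⊗ [s⁻¹] = g ⊗ [1] = 0`. -/
theorem IsRightFractions.counitMap_injective (hφ : IsRightFractions φ) :
    Function.Injective (counitMap R N (KBimod φ)) := by
  refine (injective_iff_map_eq_zero _).2 fun t ht => ?_
  obtain ⟨u, f, ⟨s, hs⟩, rfl⟩ := hφ.exists_tmul_toK_eq t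
  rw [counitMap_tmul] at ht
  let g : RHom R (KBimod φ) N := RHom.of (KBimod.lift
    (RHom.of.symm f ∘ₗ toK φ ∘ₗ QBimod.mulLeft φ ↑u⁻¹) (by
      rw [LinearMap.comp_apply, LinearMap.comp_apply, QBimod.mulLeft_of, mul_one, ht]))
  have hg : f = op s • g := RHom.ext fun k => by
    obtain ⟨q, rfl⟩ := toK_surjective φ k
    obtain ⟨q, rfl⟩ := (QBimod.of φ).surjective q
    change _ = RHom.of.symm f (toK φ (QBimod.of φ (↑u⁻¹ * (φ s * q))))
    rw [hs, Units.inv_mul_cancel_left]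
  rw [hg, Tensor.smul_tmul, smul_toK, QBimod.smul_of, hs, Units.mul_inv, ← map_one φ,
    toK_structMap, Tensor.tmul_zero]

/-- Given `x : N`, take `g : Q → N` with `g 1 = x` and a denominator `s` with `x s = 0`; then
`q ↦ g (s q)` vanishes at `1`, so that it factors through `K`, and takes the value `x` at `s⁻¹`. -/
theorem IsRightFractions.counitMap_surjective (hφ : IsRightFractions φ) (hN : IsHDivisible φ N)
    (htor : IsTorsion φ N) : Function.Surjective (counitMap R N (KBimod φ)) := by
  intro x
  obtain ⟨s, hs, hx⟩ := hφ.isTorsion_iff.1 htor x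
  obtain ⟨u, hu⟩ := isUnit_of_mem_denominators hs
  obtain ⟨g, rfl⟩ := isHDivisible_iff.1 hN x
  let f : RHom R (KBimod φ) N := RHom.of (KBimod.lift (g ∘ₗ QBimod.mulLeft φ (φ s)) (by
    rw [← map_smul, QBimod.op_smul_of, one_mul, unop_op] at hx
    rw [LinearMap.comp_apply, QBimod.mulLeft_of, mul_one, hx]))
  refine ⟨Tensor.tmul R f (toK φ (QBimod.of φ ↑u⁻¹)), ?_⟩
  change g (QBimod.of φ (φ s * ↑u⁻¹)) = _
  rw [← hu, Units.mul_inv]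

/-! ### The equivalence -/

theorem IsRightFractions.catT_tensorFunctor (hφ : IsRightFractions φ)
    (M : ModuleCat.{u} Rᵐᵒᵖ) : catT φ ((tensorFunctor R (KBimod φ)).obj M) :=
  ⟨isHDivisible_tensor, hφ.isTorsion_tensor⟩

theorem IsRightFractions.catC_homFunctor (hφ : IsRightFractions φ)
    {N : ModuleCat.{u} Rᵐᵒᵖ} (hN : catT φ N) : catC φ ((homFunctor R (KBimod φ)).obj N) :=
  ⟨hφ.isHReduced_hom, hφ.isTorsionFree_hom, hφ.isMatlisCotorsion_hom hN.1⟩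

/-- The unit as an isomorphism on an `h`-reduced torsion-free Matlis-cotorsion module. -/
noncomputable def unitIso (hφ : IsRightFractions φ) {M : ModuleCat.{u} Rᵐᵒᵖ} (hM : catC φ M) :
    M ≅ (homFunctor R (KBimod φ)).obj ((tensorFunctor R (KBimod φ)).obj M) :=
  (LinearEquiv.ofBijective (unitMap R M (KBimod φ))
    ⟨hφ.unitMap_injective hM.1 hM.2.1, hφ.unitMap_surjective hM.2.1 hM.2.2⟩).toModuleIso

/-- The counit as an isomorphism on an `h`-divisible torsion module. -/
noncomputable def counitIso (hφ : IsRightFractions φ) {N : ModuleCat.{u} Rᵐᵒᵖ} (hN : catT φ N) :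
    (tensorFunctor R (KBimod φ)).obj ((homFunctor R (KBimod φ)).obj N) ≅ N :=
  (LinearEquiv.ofBijective (counitMap R N (KBimod φ))
    ⟨hφ.counitMap_injective, hφ.counitMap_surjective hN.1 hN.2⟩).toModuleIso

end Equivalence

end Matlis

theorem mainTheorem2 {R Q : Type u} [Ring R] [Ring Q] (φ : R →+* Q)
    (hmono : Mono (RingCat.ofHom φ)) (hepi : Epi (RingCat.ofHom φ))
    (hflat : Matlis.IsLeftFlat R (Matlis.QBimod φ))
    (hfin : IsDedekindFiniteMonoid Q)
    (htop : Matlis.IsOneTopology φ) :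
    ∃ (hT : ∀ M : (Matlis.catC φ).FullSubcategory, Matlis.catT φ
        (((Matlis.catC φ).ι ⋙ Matlis.tensorFunctor R (Matlis.KBimod φ)).obj M))
      (hH : ∀ M : (Matlis.catT φ).FullSubcategory, Matlis.catC φ
        (((Matlis.catT φ).ι ⋙ Matlis.homFunctor R (Matlis.KBimod φ)).obj M))
      (e : (Matlis.catC φ).FullSubcategory ≌ (Matlis.catT φ).FullSubcategory),
      e.functor = (Matlis.catT φ).lift
          ((Matlis.catC φ).ι ⋙ Matlis.tensorFunctor R (Matlis.KBimod φ)) hT ∧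
      e.inverse = (Matlis.catC φ).lift
          ((Matlis.catT φ).ι ⋙ Matlis.homFunctor R (Matlis.KBimod φ)) hH := by
  have hφ := Matlis.isRightFractions_of_epi φ hepi hflat hfin htop
  have hT (M : (Matlis.catC φ).FullSubcategory) := hφ.catT_tensorFunctor M.obj
  have hH (N : (Matlis.catT φ).FullSubcategory) := hφ.catC_homFunctor N.property
  refine ⟨hT, hH,
    CategoryTheory.Equivalence.mk
      ((Matlis.catT φ).lift ((Matlis.catC φ).ι ⋙ Matlis.tensorFunctor R (Matlis.KBimod φ)) hT)
      ((Matlis.catC φ).lift ((Matlis.catT φ).ι ⋙ Matlis.homFunctor R (Matlis.KBimod φ)) hH)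
      (NatIso.ofComponents
        (fun M => ObjectProperty.isoMk _ (Matlis.unitIso hφ M.property)) fun f => ?_)
      (NatIso.ofComponents
        (fun N => ObjectProperty.isoMk _ (Matlis.counitIso hφ N.property)) fun {N N'} f => ?_),
    rfl, rfl⟩
  · rfl
  · refine ObjectProperty.hom_ext _ (ModuleCat.hom_ext (LinearMap.ext fun t => ?_))
    exact DFunLike.congr_fun (Matlis.Tensor.hom_ext
      (f := (Matlis.counitMap R N'.obj (Matlis.KBimod φ) ∘ₗ Matlis.Tensor.mapRight (Matlis.KBimod φ)
        (Matlis.RHom.map (Matlis.KBimod φ) f.hom.hom)).toAddMonoidHom)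
      (g := (f.hom.hom ∘ₗ Matlis.counitMap R N.obj (Matlis.KBimod φ)).toAddMonoidHom)
      fun _ _ => rfl) t
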